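/- Let $n,d\ge 1$ and let $v_1,\dots,v_n\in\mathbb R^d$ be independent standard Gaussian vectors, $v_i\sim N(0,I_d)$. Let $\mathcal A(X)=(v_i^{T}Xv_i)_{i=1}^n$ with adjoint $\mathcal A^*(z)=\sum_i z_i v_iv_i^{T}$, so that $(\mathcal A\mathcal A^*)_{ij}=\langle v_i,v_j\rangle^2$. Let $w\in\mathbb R^n$ with $w_i=\|v_i\|_2^2-d$, let $W=w1_n^T+1_nw^T+d\,1_n1_n^T$, and let $B=\mathcal A\mathcal A^*-W$. Let $h_j=H_j/\sqrt{j!}$, where $H_j$ is the $j$-th probabilists' Hermite polynomial. A shape $\alpha$ here is a bipartite graph without multi-edges between finite sets of circle vertices $\mathcal V_\circ$ and square vertices $\mathcal V_\square$, whose edges $e=\{a,x\}$ carry labels $l_e\ge 1$ (written $\{a,x\}_{l_e}$, with the label $1$ omitted), together with one left and one right circle vertex. Its graph matrix $M_\alpha\in\mathbb R^{n\times n}$ has $(i,j)$ entry $$M_\alpha(i,j)=\sum_{\pi_\circ,\pi_\square}\ \prod_{e=\{a,x\}}h_{l_e}\big((v_{\pi_\circ(a)})_{\pi_\square(x)}\big),$$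 the sum being over injective maps $\pi_\circ:\mathcal V_\circ\to[n]$ and $\pi_\square:\mathcal V_\square\to[d]$ such that $\pi_\circ$ sends the left vertex to $i$ and the right vertex to $j$. Let - $\alpha_1$: left $u$, right $v\neq u$, squares $x_1,x_2$, edges $\{u,x_1\},\{u,x_2\},\{v,x_1\},\{v,x_2\}$; - $\alpha_{2a}$: left $u$, right $v\neq u$, square $x$, edges $\{u,x\}_2,\{v,x\}_2$; - $\alpha_{3a}$: left and right $u$, squares $x_1,x_2$, edges $\{u,x_1\}_2,\{u,x_2\}_2$; - $\alpha_{3b}$: left and right $u$, square $x$, edge $\{u,x\}_2$; - $\alpha_{4}$: left and right $u$, square $x$, edge $\{u,x\}_4$; and set $$\Delta=-M_{\alpha_1}-2M_{\alpha_{2a}}-2M_{\alpha_{3a}}-(2\sqrt2\,d+2\sqrt2)M_{\alpha_{3b}}-\sqrt{24}\,M_{\alpha_4}.$$ Then $B-(d^2+d)I_n=-\Delta$ for all $v_1,\dots,v_n$. Moreover, there is a constant $K\in\mathbb N$ such that for every $c>0$ there is a constant $C>0$ such that for all $d\ge 2$ and all $n\le d^2$, with probability at least $1-d^{-c}$, $$\|B-(d^2+d)I_n\|_{op}\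 \le\ C(\log d)^K\big(d\sqrt n+n+d^{3/2}\big),$$ where $\|\cdot\|_{op}$ is the operator norm with respect to the Euclidean norm. -/

import Mathlib

open MeasureTheory ProbabilityTheory

noncomputable section

namespace EllipsoidFitting

/-- The joint law of `n` independent standard Gaussian vectors `v_1, …, v_n ∼ N(0, I_d)`;
`v i k` is the `k`-th coordinate of the `i`-th vector. -/
def gaussianVectors (n d : ℕ) : Measure (Fin n → Fin d → ℝ) :=
  Measure.pi fun _ => Measure.pi fun _ => gaussianReal 0 1

/-- The matrix of the operator `𝒜 : X ↦ (v_iᵀ X v_i)_i`; its rows are the `v_i ⊗ v_i`. -/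
def opA {n d : ℕ} (v : Fin n → Fin d → ℝ) : Matrix (Fin n) (Fin d × Fin d) ℝ :=
  Matrix.of fun i p => v i p.1 * v i p.2

/-- The vector `w` with `w_i = ‖v_i‖₂² - d`. -/
def vecW {n d : ℕ} (v : Fin n → Fin d → ℝ) : Fin n → ℝ :=
  fun i => ∑ k, v i k ^ 2 - (d : ℝ)

/-- The matrix `W = w 1ᵀ + 1 wᵀ + d 1 1ᵀ`. -/
def matW {n d : ℕ} (v : Fin n → Fin d → ℝ) : Matrix (Fin n) (Fin n) ℝ :=
  Matrix.vecMulVec (vecW v) 1 + Matrix.vecMulVec 1 (vecW v) + (d : ℝ) • Matrix.vecMulVec 1 1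

/-- The matrix `B = 𝒜 𝒜* - W`. -/
def matB {n d : ℕ} (v : Fin n → Fin d → ℝ) : Matrix (Fin n) (Fin n) ℝ :=
  opA v * (opA v).transpose - matW v

/-- The operator norm of a square matrix with respect to the Euclidean norm. -/
def opNorm {n : ℕ} (M : Matrix (Fin n) (Fin n) ℝ) : ℝ :=
  ‖Matrix.toEuclideanCLM (n := Fin n) (𝕜 := ℝ) M‖

/-- The normalized (probabilists') Hermite polynomial `h_j(z) = H_j(z) / √(j!)`. -/
def normHermite (j : ℕ) (z : ℝ) : ℝ :=
  Polynomial.aeval z (Polynomial.hermite j) / Real.sqrt (j.factorial : ℝ)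

/-- A proper shape (no multi-edges) with circle vertices `C` and square vertices `S`, whose left
and right tuples `U`, `V` each consist of a single circle vertex (possibly the same one). Every
edge joins a circle to a square and has a label `≥ 1`. -/
structure Shape (C S : Type) where
  left : C
  right : C
  edges : Finset (C × S)
  label : C × S → ℕ
  label_pos : ∀ e ∈ edges, 1 ≤ label e

/-- The `n × n` graph matrix `M_α` of the shape `α`: its `(i, j)` entry is the sum, over all
injective maps of the circle vertices to `[n]` and of the square vertices to `[d]` that send the
left vertex to `i` and the right vertex to `j`, of the product over the edges `{a, x}_l` of
`h_l` at the corresponding coordinate. -/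
def graphMatrix {C S : Type} [Fintype C] [Fintype S] [DecidableEq C] [DecidableEq S]
    (α : Shape C S) {n d : ℕ} (v : Fin n → Fin d → ℝ) : Matrix (Fin n) (Fin n) ℝ :=
  Matrix.of fun i j =>
    ∑ p : C ↪ Fin n, ∑ q : S ↪ Fin d,
      if p α.left = i ∧ p α.right = j then
        ∏ e ∈ α.edges, normHermite (α.label e) (v (p e.1) (q e.2))
      else 0

/-- `U = (u)`, `V = (v)`, `W = {x₁, x₂}`, edges `{u,x₁}, {u,x₂}, {v,x₁}, {v,x₂}`. -/
def shape1 : Shape (Fin 2) (Fin 2) where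
  left := 0
  right := 1
  edges := Finset.univ
  label := fun _ => 1
  label_pos := by simp

/-- `U = (u)`, `V = (v)`, `W = {x}`, edges `{u,x}_2, {v,x}_2`. -/
def shape2a : Shape (Fin 2) (Fin 1) where
  left := 0
  right := 1
  edges := Finset.univ
  label := fun _ => 2
  label_pos := by simp

/-- `U = V = (u)`, `W = {x₁, x₂}`, edges `{u,x₁}_2, {u,x₂}_2`. -/
def shape3a : Shape (Fin 1) (Fin 2) where
  left := 0
  right := 0
  edges := Finset.univ
  label := fun _ => 2
  label_pos := by simp

/-- `U = V = (u)`, `W = {x}`, edge `{u,x}_2`. -/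
def shape3b : Shape (Fin 1) (Fin 1) where
  left := 0
  right := 0
  edges := Finset.univ
  label := fun _ => 2
  label_pos := by simp

/-- `U = V = (u)`, `W = {x}`, edge `{u,x}_4`. -/
def shape4 : Shape (Fin 1) (Fin 1) where
  left := 0
  right := 0
  edges := Finset.univ
  label := fun _ => 4
  label_pos := by simp

/-- The matrix `Δ`, a combination of five graph matrices of proper shapes. -/
def matDelta {n d : ℕ} (v : Fin n → Fin d → ℝ) : Matrix (Fin n) (Fin n) ℝ :=
  -graphMatrix shape1 v - (2 : ℝ) • graphMatrix shape2a v - (2 : ℝ) • graphMatrix shape3a v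
    - (2 * Real.sqrt 2 * (d : ℝ) + 2 * Real.sqrt 2) • graphMatrix shape3b v
    - Real.sqrt 24 • graphMatrix shape4 v

end EllipsoidFitting

end

namespace EllipsoidFitting

/-! The identity is a Hermite expansion of each entry. For the norm bound, `B` is the Gram matrix of
the centred matrices `v_i v_iᵀ - I` under the Frobenius product (`chaos_centeredOuter`); no moment
estimates for graph matrices are needed. For disjoint `I`, `J` put `U_J = ∑_{j ∈ J} (v_j v_jᵀ - I)`.
Given the vectors in `J`, the block sum of `B` over `I × J` is a sum of `|I|` independent centred
quadratic forms of scale `‖U_J‖_F`, each with an exponential moment. It exceeds `t |I| ‖U_J‖_F` with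
probability at most `2 exp((1 - t/4)|I|)`, and for `t` of order `log d` this beats the number of
pairs with `|J| ≤ |I|`. The Gram structure also gives `‖U_J‖_F² ≤ (D + X)|J|`, where `D` bounds the
diagonal of `B` and `X` is the norm of its off-diagonal part. Passing from indicators to all vectors
(`abs_bilin_le`) and from disjoint blocks to the whole matrix (`abs_sum_le_of_decoupled`) loses only
logarithms and constants, so `X ≤ s √(D + X)` with `s` of order `√n` up to logarithms. Solving this
with `√D` of order `t d` gives `n + d√n`; the diagonal contributes `d^{3/2}` through `‖v_i‖² - d`.
-/

/-- The centred quadratic form `xᵀ U x - tr U`, that is `⟨x xᵀ - I, U⟩`. -/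
noncomputable def chaos {d : ℕ} (U : Matrix (Fin d) (Fin d) ℝ) (x : Fin d → ℝ) : ℝ :=
  ∑ a, ∑ b, U a b * (x a * x b) - U.trace

/-- The squared Frobenius norm. -/
def frobSq {d : ℕ} (U : Matrix (Fin d) (Fin d) ℝ) : ℝ := ∑ a, ∑ b, U a b ^ 2

/-! ### Exponential moments of Gaussian quadratic forms. -/

/-- A bound quadratic in `s` makes the product over eigenvalues depend on the Frobenius norm only.
Squaring reduces it to `exp(-s - s²) ≤ 1 - s`. -/
lemma exp_neg_half_div_sqrt_le {s : ℝ} (hs : |s| ≤ 1 / 2) :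
    Real.exp (-s / 2) * (Real.sqrt (1 - s))⁻¹ ≤ Real.exp (s ^ 2 / 2) := by
  obtain ⟨h1, h2⟩ := abs_le.mp hs
  have hpos : 0 < 1 - s := by linarith
  have key : Real.exp (-s - s ^ 2) ≤ 1 - s := by
    have h3 : 1 ≤ Real.exp (s + s ^ 2) * (1 - s) := by
      -- Since `(1 + s + s²)(1 - s) = 1 - s³`, the linear bound on `exp` suffices only for `s ≤ 0`;
      -- otherwise the quadratic term is needed.
      rcases le_total 0 s with h0 | h0
      · have h4 := Real.quadratic_le_exp_of_nonneg (show 0 ≤ s + s ^ 2 by positivity)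
        refine le_trans ?_ (mul_le_mul_of_nonneg_right h4 hpos.le)
        have h5 : 2 * s ≤ (1 + s) ^ 2 * (1 - s) := by nlinarith [mul_nonneg h0 h0]
        nlinarith [mul_nonneg (sq_nonneg s) (sub_nonneg.mpr h5)]
      · refine le_trans ?_ (mul_le_mul_of_nonneg_right (Real.add_one_le_exp (s + s ^ 2)) hpos.le)
        nlinarith [mul_nonneg (sq_nonneg s) (neg_nonneg.mpr h0)]
    have h4 : -s - s ^ 2 = -(s + s ^ 2) := by ring
    rw [h4, Real.exp_neg, inv_le_iff_one_le_mul₀' (Real.exp_pos _)]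
    exact h3
  have h6 : Real.exp (-s / 2 - s ^ 2 / 2) ≤ Real.sqrt (1 - s) := by
    apply Real.le_sqrt_of_sq_le
    rw [← Real.exp_nat_mul]
    convert key using 2
    push_cast; ring
  rw [← div_eq_mul_inv, div_le_iff₀ (Real.sqrt_pos.mpr hpos)]
  calc Real.exp (-s / 2) = Real.exp (s ^ 2 / 2) * Real.exp (-s / 2 - s ^ 2 / 2) := by
        rw [← Real.exp_add]; ring_nf
    _ ≤ _ := by gcongr

lemma integral_exp_sq_gaussian {s : ℝ} (hs : s < 1) :
    Integrable (fun x : ℝ => Real.exp (s * (x ^ 2 - 1) / 2)) (gaussianReal 0 1) ∧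
    ∫ x, Real.exp (s * (x ^ 2 - 1) / 2) ∂(gaussianReal 0 1)
      = Real.exp (-s / 2) * (Real.sqrt (1 - s))⁻¹ := by
  have hpos : 0 < (1 - s) / 2 := by linarith
  have hpdf : ∀ x : ℝ, gaussianPDFReal 0 1 x * Real.exp (s * (x ^ 2 - 1) / 2)
      = ((Real.sqrt (2 * Real.pi))⁻¹ * Real.exp (-s / 2)) * Real.exp (-((1 - s) / 2) * x ^ 2) := by
    intro x
    simp only [gaussianPDFReal, NNReal.coe_one, mul_one, sub_zero]
    rw [mul_assoc, mul_assoc, ← Real.exp_add, ← Real.exp_add]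
    congr 2
    ring
  constructor
  · rw [gaussianReal_of_var_ne_zero _ one_ne_zero, gaussianPDF_def,
      integrable_withDensity_iff_integrable_smul₀' (by fun_prop) (by simp)]
    have : ∀ x : ℝ, (ENNReal.ofReal (gaussianPDFReal 0 1 x)).toReal • Real.exp (s * (x ^ 2 - 1) / 2)
      = ((Real.sqrt (2 * Real.pi))⁻¹ * Real.exp (-s / 2)) * Real.exp (-((1 - s) / 2) * x ^ 2) := by
      intro x
      rw [ENNReal.toReal_ofReal (gaussianPDFReal_nonneg _ _ _), smul_eq_mul, hpdf]
    simp_rw [this]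
    exact (integrable_exp_neg_mul_sq hpos).const_mul _
  · rw [integral_gaussianReal_eq_integral_smul one_ne_zero]
    simp_rw [smul_eq_mul, hpdf]
    rw [integral_const_mul, integral_gaussian]
    have : Real.pi / ((1 - s) / 2) = (2 * Real.pi) * (1 - s)⁻¹ := by
      field_simp
    rw [this, Real.sqrt_mul (x := 2 * Real.pi) (by positivity), Real.sqrt_inv]
    have : Real.sqrt (2 * Real.pi) ≠ 0 := by positivity
    field_simp

/-- Parseval for the rows of `U` in the eigenbasis, whose coefficients are the entries of `λ_i e_i`.
-/
lemma sum_sq_eigenvalues {d : ℕ} {U : Matrix (Fin d) (Fin d) ℝ} (hU : U.IsHermitian) :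
    ∑ i, hU.eigenvalues i ^ 2 = frobSq U := by
  have h1 : ∀ i, hU.eigenvalues i ^ 2
      = ∑ a, (inner ℝ (WithLp.toLp 2 (U a) : EuclideanSpace ℝ (Fin d)) (hU.eigenvectorBasis i)) ^ 2 := by
    intro i
    have h2 : ∀ a, inner ℝ (WithLp.toLp 2 (U a) : EuclideanSpace ℝ (Fin d)) (hU.eigenvectorBasis i)
        = hU.eigenvalues i * hU.eigenvectorBasis i a := by
      intro a
      have := congrFun (hU.mulVec_eigenvectorBasis i) a
      simp only [Pi.smul_apply, smul_eq_mul] at this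
      rw [← this]
      simp [PiLp.inner_apply, Matrix.mulVec, dotProduct, mul_comm]
    simp_rw [h2, mul_pow, ← Finset.mul_sum]
    have h3 := hU.eigenvectorBasis.norm_eq_one i
    rw [EuclideanSpace.norm_eq, Real.sqrt_eq_one] at h3
    simp only [Real.norm_eq_abs, sq_abs] at h3
    rw [h3, mul_one]
  simp_rw [h1]
  rw [Finset.sum_comm]
  unfold frobSq
  refine Finset.sum_congr rfl fun a _ => ?_
  rw [hU.eigenvectorBasis.sum_sq_inner_left, EuclideanSpace.norm_sq_eq]
  simp

lemma chaos_eigenvectorBasis {d : ℕ} {U : Matrix (Fin d) (Fin d) ℝ} (hU : U.IsHermitian)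
    (y : Fin d → ℝ) :
    chaos U (∑ i, y i • hU.eigenvectorBasis i : EuclideanSpace ℝ (Fin d)).ofLp
      = ∑ i, hU.eigenvalues i * (y i ^ 2 - 1) := by
  set x : EuclideanSpace ℝ (Fin d) := ∑ i, y i • hU.eigenvectorBasis i with hx
  have h1 : U.mulVec x.ofLp = (∑ i, (y i * hU.eigenvalues i) • hU.eigenvectorBasis i :
      EuclideanSpace ℝ (Fin d)).ofLp := by
    rw [hx, WithLp.ofLp_sum, WithLp.ofLp_sum, Matrix.mulVec_sum]
    refine Finset.sum_congr rfl fun i _ => ?_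
    rw [WithLp.ofLp_smul, WithLp.ofLp_smul, Matrix.mulVec_smul, hU.mulVec_eigenvectorBasis, smul_smul]
  have h2 : ∑ a, ∑ b, U a b * (x a * x b) = inner ℝ x (WithLp.toLp 2 (U.mulVec x.ofLp)) := by
    simp only [PiLp.inner_apply, Matrix.mulVec, dotProduct, RCLike.inner_apply, conj_trivial,
      Finset.sum_mul]
    refine Finset.sum_congr rfl fun a _ => Finset.sum_congr rfl fun b _ => by ring
  have h3 : U.trace = ∑ i, hU.eigenvalues i := by
    simpa using hU.trace_eq_sum_eigenvalues
  rw [chaos, h2, h1, WithLp.toLp_ofLp, h3, hx, hU.eigenvectorBasis.orthonormal.inner_sum,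
    ← Finset.sum_sub_distrib]
  refine Finset.sum_congr rfl fun i _ => ?_
  simp; ring

lemma measurable_chaos {d : ℕ} (U : Matrix (Fin d) (Fin d) ℝ) : Measurable (chaos U) := by
  unfold chaos; fun_prop

/-- Exponential integrability of a centred Gaussian quadratic form. -/
lemma lintegral_exp_chaos_le {d : ℕ} {U : Matrix (Fin d) (Fin d) ℝ} (hU : U.IsHermitian)
    (h1 : frobSq U ≤ 1) :
    ∫⁻ x, ENNReal.ofReal (Real.exp (chaos U x / 4)) ∂(Measure.pi fun _ => gaussianReal 0 1)
      ≤ ENNReal.ofReal (Real.exp 1) := by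
  have hm : Measurable fun x : Fin d → ℝ => ENNReal.ofReal (Real.exp (chaos U x / 4)) := by
    have := measurable_chaos U
    fun_prop
  have hm2 : Measurable fun z : EuclideanSpace ℝ (Fin d) =>
      ENNReal.ofReal (Real.exp (chaos U z.ofLp / 4)) :=
    hm.comp (by fun_prop)
  have e1 : ∫⁻ x, ENNReal.ofReal (Real.exp (chaos U x / 4)) ∂(Measure.pi fun _ => gaussianReal 0 1)
      = ∫⁻ y : Fin d → ℝ, ENNReal.ofReal (∏ i, Real.exp (hU.eigenvalues i / 2 * (y i ^ 2 - 1) / 2))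
        ∂(Measure.pi fun _ => gaussianReal 0 1) := by
    -- Rotation invariance: the coordinates in the eigenbasis are again independent standard
    -- Gaussians.
    have a1 := lintegral_map (μ := Measure.pi fun _ : Fin d => gaussianReal 0 1) hm2
      (g := WithLp.toLp 2) (by fun_prop)
    rw [map_pi_eq_stdGaussian, stdGaussian_eq_map_pi_orthonormalBasis hU.eigenvectorBasis,
      lintegral_map hm2 (by fun_prop)] at a1
    rw [← a1]
    refine lintegral_congr fun y => ?_
    rw [chaos_eigenvectorBasis hU, ← Real.exp_sum, Finset.sum_div]
    congr 2
    exact Finset.sum_congr rfl fun i _ => by ring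
  -- The factor `1/4` in the exponent keeps every one-dimensional parameter `λ_i / 2` within `[-1/2,
  -- 1/2]`.
  have hlam : ∀ i, |hU.eigenvalues i / 2| ≤ 1 / 2 := by
    intro i
    have : hU.eigenvalues i ^ 2 ≤ 1 := by
      refine le_trans ?_ h1
      rw [← sum_sq_eigenvalues hU]
      exact Finset.single_le_sum (f := fun i => hU.eigenvalues i ^ 2) (fun _ _ => sq_nonneg _)
        (Finset.mem_univ i)
    rw [sq_le_one_iff_abs_le_one] at this
    rw [abs_div, abs_two]; linarith
  have hlt : ∀ i, hU.eigenvalues i / 2 < 1 := fun i => by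
    have := (abs_le.mp (hlam i)).2
    linarith
  rw [e1, ← ofReal_integral_eq_lintegral_ofReal
    (Integrable.fintype_prod (f := fun i (t : ℝ) => Real.exp (hU.eigenvalues i / 2 * (t ^ 2 - 1) / 2))
      fun i => (integral_exp_sq_gaussian (hlt i)).1)
    (Filter.Eventually.of_forall fun y => Finset.prod_nonneg fun i _ => (Real.exp_pos _).le)]
  apply ENNReal.ofReal_le_ofReal
  rw [integral_fintype_prod_eq_prod
    (f := fun i (t : ℝ) => Real.exp (hU.eigenvalues i / 2 * (t ^ 2 - 1) / 2))]
  calc _ = ∏ i, (Real.exp (-(hU.eigenvalues i / 2) / 2) * (Real.sqrt (1 - hU.eigenvalues i / 2))⁻¹) :=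
        Finset.prod_congr rfl fun i _ => (integral_exp_sq_gaussian (hlt i)).2
    _ ≤ ∏ i, Real.exp ((hU.eigenvalues i / 2) ^ 2 / 2) :=
        Finset.prod_le_prod (fun i _ => by positivity) fun i _ => exp_neg_half_div_sqrt_le (hlam i)
    _ = Real.exp (frobSq U / 8) := by
        rw [← Real.exp_sum, ← sum_sq_eigenvalues hU, Finset.sum_div]
        congr 1
        exact Finset.sum_congr rfl fun i _ => by ring
    _ ≤ Real.exp 1 := Real.exp_le_exp.mpr (by linarith)

/-! ### Entries of the graph matrices and the Hermite identity. -/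

lemma sum_embedding_fin_two {m : ℕ} (f : Fin m → Fin m → ℝ) :
    ∑ p : Fin 2 ↪ Fin m, f (p 0) (p 1) = ∑ a, ∑ b, if a ≠ b then f a b else 0 := by
  rw [← Finset.sum_product', ← Finset.sum_filter]
  refine Finset.sum_bij (fun p _ => (p 0, p 1)) (fun p _ => by simp) ?_ ?_ (fun _ _ => rfl)
  · intro p _ q _ h
    ext k
    simp only [Prod.mk.injEq] at h
    fin_cases k <;> simp [h.1, h.2]
  · rintro ⟨a, b⟩ h
    simp only [Finset.univ_product_univ, Finset.mem_filter, Finset.mem_univ, true_and] at h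
    refine ⟨⟨![a, b], ?_⟩, Finset.mem_univ _, rfl⟩
    intro k l hkl
    fin_cases k <;> fin_cases l <;> simp_all

lemma sum_embedding_fin_one {m : ℕ} (f : Fin m → ℝ) :
    ∑ p : Fin 1 ↪ Fin m, f (p 0) = ∑ a, f a := by
  refine Finset.sum_bij (fun p _ => p 0) (fun p _ => by simp) ?_ ?_ (fun _ _ => rfl)
  · intro p _ q _ h
    ext k
    fin_cases k; simp [h]
  · intro a _
    refine ⟨⟨fun _ => a, fun k l _ => Subsingleton.elim _ _⟩, Finset.mem_univ _, rfl⟩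

lemma sum_offDiag_mul {m : ℕ} (f : Fin m → ℝ) :
    (∑ a, ∑ b, if a ≠ b then f a * f b else 0) = (∑ a, f a) ^ 2 - ∑ a, f a ^ 2 := by
  have : ∀ a b, (if a ≠ b then f a * f b else 0) = f a * f b - if a = b then f a * f b else 0 := by
    intro a b; by_cases h : a = b <;> simp [h]
  simp_rw [this, Finset.sum_sub_distrib, sq, Finset.sum_mul_sum]
  simp

lemma normHermite_one (z : ℝ) : normHermite 1 z = z := by
  simp [normHermite]

lemma normHermite_two (z : ℝ) : normHermite 2 z = (z ^ 2 - 1) / Real.sqrt 2 := by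
  simp [normHermite, Polynomial.hermite_succ, Nat.factorial]; ring_nf

lemma normHermite_four (z : ℝ) :
    normHermite 4 z = (z ^ 4 - 6 * z ^ 2 + 3) / Real.sqrt 24 := by
  simp [normHermite, Polynomial.hermite_succ, Nat.factorial]; ring_nf

section entries
variable {n d : ℕ} (v : Fin n → Fin d → ℝ) (i j : Fin n)

lemma graphMatrix_shape1 : graphMatrix shape1 v i j =
    if i = j then 0 else (∑ x, v i x * v j x) ^ 2 - ∑ x, (v i x * v j x) ^ 2 := by
  have h : ∀ p : Fin 2 ↪ Fin n, (∑ q : Fin 2 ↪ Fin d, if p 0 = i ∧ p 1 = j then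
      ∏ e : Fin 2 × Fin 2, normHermite 1 (v (p e.1) (q e.2)) else 0)
      = if p 0 = i ∧ p 1 = j then
        (∑ x, v (p 0) x * v (p 1) x) ^ 2 - ∑ x, (v (p 0) x * v (p 1) x) ^ 2 else 0 := by
    intro p
    split_ifs
    · rw [← sum_offDiag_mul, ← sum_embedding_fin_two]
      refine Finset.sum_congr rfl fun q _ => ?_
      simp [Fintype.prod_prod_type, normHermite_one]; ring
    · simp
  have e : graphMatrix shape1 v i j = _ := Finset.sum_congr rfl fun p _ => h p
  rw [e]
  rw [sum_embedding_fin_two (fun a b => if a = i ∧ b = j then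
    (∑ x, v a x * v b x) ^ 2 - ∑ x, (v a x * v b x) ^ 2 else 0)]
  rw [Finset.sum_eq_single i, Finset.sum_eq_single j]
  · by_cases hij : i = j <;> simp [hij]
  · intro b _ hb; simp [hb]
  · simp
  · intro b _ hb; simp [hb]
  · simp

/-- The factor `2` cancels the two normalisations `√2` of `h_2`. -/
lemma graphMatrix_shape2a : 2 * graphMatrix shape2a v i j =
    if i = j then 0 else ∑ x, (v i x ^ 2 - 1) * (v j x ^ 2 - 1) := by
  have h : ∀ p : Fin 2 ↪ Fin n, (∑ q : Fin 1 ↪ Fin d, if p 0 = i ∧ p 1 = j then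
      ∏ e : Fin 2 × Fin 1, normHermite 2 (v (p e.1) (q e.2)) else 0)
      = if p 0 = i ∧ p 1 = j then
        (∑ x, (v (p 0) x ^ 2 - 1) * (v (p 1) x ^ 2 - 1)) / 2 else 0 := by
    intro p
    split_ifs
    · rw [Finset.sum_div, ← sum_embedding_fin_one]
      refine Finset.sum_congr rfl fun q _ => ?_
      simp only [Fintype.prod_prod_type, normHermite_two, Fin.prod_univ_two, Fin.prod_univ_one]
      rw [div_mul_div_comm, Real.mul_self_sqrt (by norm_num)]
    · simp
  have e : graphMatrix shape2a v i j = _ := Finset.sum_congr rfl fun p _ => h p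
  rw [e]
  rw [sum_embedding_fin_two (fun a b => if a = i ∧ b = j then
    (∑ x, (v a x ^ 2 - 1) * (v b x ^ 2 - 1)) / 2 else 0)]
  rw [Finset.sum_eq_single i, Finset.sum_eq_single j]
  · by_cases hij : i = j
    · simp [hij]
    · simp [hij]; ring
  · intro b _ hb; simp [hb]
  · simp
  · intro b _ hb; simp [hb]
  · simp

lemma graphMatrix_shape3a : 2 * graphMatrix shape3a v i j =
    if i = j then (∑ x, (v i x ^ 2 - 1)) ^ 2 - ∑ x, (v i x ^ 2 - 1) ^ 2 else 0 := by
  have h : ∀ p : Fin 1 ↪ Fin n, (∑ q : Fin 2 ↪ Fin d, if p 0 = i ∧ p 0 = j then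
      ∏ e : Fin 1 × Fin 2, normHermite 2 (v (p e.1) (q e.2)) else 0)
      = if p 0 = i ∧ p 0 = j then
        ((∑ x, (v (p 0) x ^ 2 - 1)) ^ 2 - ∑ x, (v (p 0) x ^ 2 - 1) ^ 2) / 2 else 0 := by
    intro p
    split_ifs
    · rw [← sum_offDiag_mul, ← sum_embedding_fin_two, Finset.sum_div]
      refine Finset.sum_congr rfl fun q _ => ?_
      simp only [Fintype.prod_prod_type, normHermite_two, Fin.prod_univ_two, Fin.prod_univ_one]
      rw [div_mul_div_comm, Real.mul_self_sqrt (by norm_num)]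
    · simp
  have e : graphMatrix shape3a v i j = _ := Finset.sum_congr rfl fun p _ => h p
  rw [e]
  rw [sum_embedding_fin_one (fun a => if a = i ∧ a = j then
    ((∑ x, (v a x ^ 2 - 1)) ^ 2 - ∑ x, (v a x ^ 2 - 1) ^ 2) / 2 else 0)]
  rw [Finset.sum_eq_single i]
  · by_cases hij : i = j
    · simp only [hij, and_self, if_true]; ring
    · simp [hij]
  · intro b _ hb; simp [hb]
  · simp

lemma graphMatrix_shape3b : graphMatrix shape3b v i j =
    if i = j then (∑ x, (v i x ^ 2 - 1)) / Real.sqrt 2 else 0 := by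
  have h : ∀ p : Fin 1 ↪ Fin n, (∑ q : Fin 1 ↪ Fin d, if p 0 = i ∧ p 0 = j then
      ∏ e : Fin 1 × Fin 1, normHermite 2 (v (p e.1) (q e.2)) else 0)
      = if p 0 = i ∧ p 0 = j then (∑ x, (v (p 0) x ^ 2 - 1)) / Real.sqrt 2 else 0 := by
    intro p
    split_ifs
    · rw [Finset.sum_div, ← sum_embedding_fin_one]
      refine Finset.sum_congr rfl fun q _ => ?_
      simp only [Fintype.prod_prod_type, normHermite_two, Fin.prod_univ_one]
    · simp
  have e : graphMatrix shape3b v i j = _ := Finset.sum_congr rfl fun p _ => h p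
  rw [e]
  rw [sum_embedding_fin_one (fun a => if a = i ∧ a = j then
    (∑ x, (v a x ^ 2 - 1)) / Real.sqrt 2 else 0)]
  rw [Finset.sum_eq_single i]
  · by_cases hij : i = j <;> simp [hij]
  · intro b _ hb; simp [hb]
  · simp

lemma graphMatrix_shape4 : Real.sqrt 24 * graphMatrix shape4 v i j =
    if i = j then ∑ x, (v i x ^ 4 - 6 * v i x ^ 2 + 3) else 0 := by
  have h : ∀ p : Fin 1 ↪ Fin n, (∑ q : Fin 1 ↪ Fin d, if p 0 = i ∧ p 0 = j then
      ∏ e : Fin 1 × Fin 1, normHermite 4 (v (p e.1) (q e.2)) else 0)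
      = if p 0 = i ∧ p 0 = j then
        (∑ x, (v (p 0) x ^ 4 - 6 * v (p 0) x ^ 2 + 3)) / Real.sqrt 24 else 0 := by
    intro p
    split_ifs
    · rw [Finset.sum_div, ← sum_embedding_fin_one]
      refine Finset.sum_congr rfl fun q _ => ?_
      simp only [Fintype.prod_prod_type, normHermite_four, Fin.prod_univ_one]
    · simp
  have e : graphMatrix shape4 v i j = _ := Finset.sum_congr rfl fun p _ => h p
  rw [e]
  rw [sum_embedding_fin_one (fun a => if a = i ∧ a = j then
    (∑ x, (v a x ^ 4 - 6 * v a x ^ 2 + 3)) / Real.sqrt 24 else 0)]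
  rw [Finset.sum_eq_single i]
  · by_cases hij : i = j
    · simp only [hij, and_self, if_true]
      rw [mul_div_cancel₀]; positivity
    · simp [hij]
  · intro b _ hb; simp [hb]
  · simp

lemma matB_apply : matB v i j =
    (∑ x, v i x * v j x) ^ 2 - (∑ x, v i x ^ 2 + ∑ x, v j x ^ 2 - d) := by
  simp only [matB, opA, matW, vecW, Matrix.sub_apply, Matrix.mul_apply, Matrix.of_apply,
    Matrix.transpose_apply, Fintype.sum_prod_type, Matrix.add_apply, Matrix.vecMulVec_apply,
    Matrix.smul_apply, Pi.one_apply, smul_eq_mul]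
  rw [sq, Finset.sum_mul_sum]
  have : ∀ x y, v i x * v i y * (v j x * v j y) = v i x * v j x * (v i y * v j y) := by
    intros; ring
  simp_rw [this]
  ring

end entries

/-- On the diagonal, `(z² - 1)² = H_4(z) + 4(z² - 1) + 2`: the constant `2`, summed over
coordinates, turns `d² - d` into `d² + d`, and the middle term turns `2d - 2` into `2d + 2`. -/
theorem matB_sub_eq_neg_matDelta {n d : ℕ} (v : Fin n → Fin d → ℝ) :
    matB v - ((d : ℝ) ^ 2 + (d : ℝ)) • (1 : Matrix (Fin n) (Fin n) ℝ) = -matDelta v := by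
  ext i j
  have h3b : (2 * Real.sqrt 2 * (d : ℝ) + 2 * Real.sqrt 2) * graphMatrix shape3b v i j
      = if i = j then (2 * (d : ℝ) + 2) * ∑ x, (v i x ^ 2 - 1) else 0 := by
    rw [graphMatrix_shape3b]
    have : Real.sqrt 2 ≠ 0 := by positivity
    split_ifs
    · field_simp
    · simp
  simp only [matDelta, Matrix.sub_apply, Matrix.neg_apply, Matrix.smul_apply, smul_eq_mul,
    graphMatrix_shape1, graphMatrix_shape2a, graphMatrix_shape3a, h3b, graphMatrix_shape4,
    matB_apply]
  by_cases hij : i = j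
  · subst hij
    have e1 : ∀ x, v i x * v i x = v i x ^ 2 := fun x => by ring
    have e2 : ∀ x, (v i x ^ 2 - 1) ^ 2 = v i x ^ 4 - 2 * v i x ^ 2 + 1 := fun x => by ring
    simp only [if_true, Matrix.one_apply_eq, e1, e2, Finset.sum_add_distrib,
      Finset.sum_sub_distrib, ← Finset.mul_sum, Finset.sum_const, Finset.card_univ,
      Fintype.card_fin, nsmul_eq_mul]
    ring
  · have e1 : ∀ x, (v i x ^ 2 - 1) * (v j x ^ 2 - 1)
        = (v i x * v j x) ^ 2 - v i x ^ 2 - v j x ^ 2 + 1 := fun x => by ring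
    simp only [hij, if_false, Matrix.one_apply_ne hij, e1, Finset.sum_add_distrib,
      Finset.sum_sub_distrib, Finset.sum_const, Finset.card_univ, Fintype.card_fin, nsmul_eq_mul]
    ring

/-! ### `B` as a Gram matrix. -/

/-- The matrix `x xᵀ - I`. -/
def centeredOuter {d : ℕ} (x : Fin d → ℝ) : Matrix (Fin d) (Fin d) ℝ :=
  Matrix.vecMulVec x x - 1

lemma chaos_eq_sum_centeredOuter {d : ℕ} (U : Matrix (Fin d) (Fin d) ℝ) (x : Fin d → ℝ) :
    chaos U x = ∑ a, ∑ b, centeredOuter x a b * U a b := by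
  simp only [chaos, centeredOuter, Matrix.sub_apply, Matrix.vecMulVec_apply, Matrix.trace,
    Matrix.diag_apply, sub_mul, Finset.sum_sub_distrib, Matrix.one_apply, ite_mul, one_mul, zero_mul,
    Finset.sum_ite_eq, Finset.mem_univ, if_true]
  simp_rw [mul_comm]

/-- Subtracting `W` is exactly the centring of both factors in `⟨v_i v_iᵀ, v_j v_jᵀ⟩`. -/
lemma chaos_centeredOuter {n d : ℕ} (v : Fin n → Fin d → ℝ) (i j : Fin n) :
    chaos (centeredOuter (v j)) (v i) = matB v i j := by
  rw [matB_apply, chaos]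
  simp only [centeredOuter, Matrix.trace, Matrix.diag_apply, Matrix.sub_apply,
    Matrix.vecMulVec_apply, sub_mul, Finset.sum_sub_distrib, Matrix.one_apply, ite_mul, one_mul,
    zero_mul, Finset.sum_ite_eq, Finset.mem_univ, if_true, Finset.sum_const, Finset.card_univ,
    Fintype.card_fin, nsmul_eq_mul, mul_one]
  rw [sq, Finset.sum_mul_sum]
  have : ∀ x y, v j x * v j y * (v i x * v i y) = v i x * v j x * (v i y * v j y) := by
    intros; ring
  simp_rw [this, ← sq]
  ring

lemma chaos_sum {d : ℕ} {ι : Type*} (J : Finset ι) (U : ι → Matrix (Fin d) (Fin d) ℝ)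
    (x : Fin d → ℝ) : chaos (∑ j ∈ J, U j) x = ∑ j ∈ J, chaos (U j) x := by
  simp only [chaos_eq_sum_centeredOuter, Matrix.sum_apply, Finset.mul_sum]
  rw [Finset.sum_comm (s := J)]
  refine Finset.sum_congr rfl fun a _ => ?_
  rw [Finset.sum_comm]

lemma frobSq_sum_centeredOuter {n d : ℕ} (v : Fin n → Fin d → ℝ) (J : Finset (Fin n)) :
    frobSq (∑ j ∈ J, centeredOuter (v j)) = ∑ i ∈ J, ∑ j ∈ J, matB v i j := by
  have h : ∀ i, ∑ j ∈ J, matB v i j = chaos (∑ j ∈ J, centeredOuter (v j)) (v i) := by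
    intro i
    rw [chaos_sum]
    refine Finset.sum_congr rfl fun j _ => ?_
    rw [chaos_centeredOuter]
  simp_rw [h, chaos_eq_sum_centeredOuter, frobSq]
  rw [Finset.sum_comm (s := J)]
  refine Finset.sum_congr rfl fun a _ => ?_
  rw [Finset.sum_comm (s := J)]
  refine Finset.sum_congr rfl fun b _ => ?_
  rw [← Finset.sum_mul, sq]
  simp only [Matrix.sum_apply]

/-! ### From indicator vectors to arbitrary vectors. -/

lemma harmonic_nonneg (n : ℕ) : (0 : ℝ) ≤ harmonic n := by
  have : (0 : ℚ) ≤ harmonic n := Finset.sum_nonneg fun i _ => by positivity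
  exact_mod_cast this

lemma harmonic_mono {m n : ℕ} (h : m ≤ n) : (harmonic m : ℝ) ≤ harmonic n := by
  have : harmonic m ≤ harmonic n :=
    Finset.sum_le_sum_of_subset_of_nonneg (Finset.range_mono h) fun i _ _ => by positivity
  exact_mod_cast this

/-- If all subset sums of `a` are at most `A √|S|`, then `a` is in `ℓ²` up to a logarithm. -/
lemma sum_sq_le_harmonic {ι : Type*} [DecidableEq ι] {a : ι → ℝ} {A : ℝ} (hA : 0 ≤ A) (T : Finset ι)
    (h : ∀ S ⊆ T, |∑ i ∈ S, a i| ≤ A * Real.sqrt S.card) :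
    ∑ i ∈ T, a i ^ 2 ≤ 4 * A ^ 2 * harmonic T.card := by
  induction hk : T.card generalizing T with
  | zero =>
    rw [Finset.card_eq_zero] at hk
    simp [hk]
  | succ k ih =>
    have hne : T.Nonempty := by
      rw [← Finset.card_pos, hk]; exact Nat.succ_pos k
    -- The smallest `|a m|` is at most the average `2A / √|T|`, so `a m ^ 2 ≤ 4A² / |T|`; deleting
    -- entries one by one sums `1/k`.
    obtain ⟨m, hm, hmin⟩ := T.exists_min_image (fun i => |a i|) hne
    have hsum : ∑ i ∈ T, |a i| ≤ 2 * A * Real.sqrt T.card := by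
      have hp := h (T.filter fun i => 0 ≤ a i) (Finset.filter_subset _ _)
      have hn := h (T.filter fun i => ¬ 0 ≤ a i) (Finset.filter_subset _ _)
      have hcp : Real.sqrt (T.filter fun i => 0 ≤ a i).card ≤ Real.sqrt T.card :=
        Real.sqrt_le_sqrt (by exact_mod_cast Finset.card_filter_le _ _)
      have hcn : Real.sqrt (T.filter fun i => ¬ 0 ≤ a i).card ≤ Real.sqrt T.card :=
        Real.sqrt_le_sqrt (by exact_mod_cast Finset.card_filter_le _ _)
      rw [← Finset.sum_filter_add_sum_filter_not T (fun i => 0 ≤ a i)]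
      have e1 : ∑ i ∈ T.filter (fun i => 0 ≤ a i), |a i| = ∑ i ∈ T.filter (fun i => 0 ≤ a i), a i :=
        Finset.sum_congr rfl fun i hi => abs_of_nonneg (Finset.mem_filter.mp hi).2
      have e2 : ∑ i ∈ T.filter (fun i => ¬ 0 ≤ a i), |a i|
          = -∑ i ∈ T.filter (fun i => ¬ 0 ≤ a i), a i := by
        rw [← Finset.sum_neg_distrib]
        exact Finset.sum_congr rfl fun i hi => abs_of_neg (not_le.mp (Finset.mem_filter.mp hi).2)
      rw [e1, e2]
      have := mul_le_mul_of_nonneg_left hcp hA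
      have := mul_le_mul_of_nonneg_left hcn hA
      have := le_abs_self (∑ i ∈ T.filter (fun i => 0 ≤ a i), a i)
      have := neg_abs_le (∑ i ∈ T.filter (fun i => ¬ 0 ≤ a i), a i)
      linarith
    have hcard : (T.card : ℝ) * |a m| ≤ ∑ i ∈ T, |a i| := by
      rw [← nsmul_eq_mul]
      exact Finset.card_nsmul_le_sum _ _ _ hmin
    have hk' : (T.card : ℝ) = k + 1 := by rw [hk]; push_cast; ring
    have hm2 : a m ^ 2 ≤ 4 * A ^ 2 * ((k : ℝ) + 1)⁻¹ := by
      have h1 := pow_le_pow_left₀ (by positivity) (hcard.trans hsum) 2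
      rw [mul_pow, mul_pow, sq_abs, Real.sq_sqrt (by positivity), hk'] at h1
      have hpos : (0 : ℝ) < k + 1 := by positivity
      rw [← div_eq_mul_inv, le_div_iff₀ hpos]
      have : ((k : ℝ) + 1) * (a m ^ 2 * (k + 1)) ≤ (k + 1) * (4 * A ^ 2) := by nlinarith
      exact le_of_mul_le_mul_left this hpos
    have hrec := ih (T.erase m)
      (fun S hS => h S (hS.trans (Finset.erase_subset _ _))) (by rw [Finset.card_erase_of_mem hm, hk]; rfl)
    rw [← Finset.add_sum_erase T _ hm, harmonic_succ]
    push_cast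
    linarith

/-- Cauchy–Schwarz against the `ℓ²` bound. Each use costs `√(harmonic n)`; a bilinear form needs one
per variable. -/
lemma abs_sum_mul_le {ι : Type*} [DecidableEq ι] {a : ι → ℝ} {A : ℝ} (hA : 0 ≤ A) (T : Finset ι)
    {n : ℕ} (hT : T.card ≤ n)
    (h : ∀ S ⊆ T, |∑ i ∈ S, a i| ≤ A * Real.sqrt S.card) (x : ι → ℝ) :
    |∑ i ∈ T, x i * a i| ≤ 2 * A * Real.sqrt (harmonic n) * Real.sqrt (∑ i ∈ T, x i ^ 2) := by
  have h1 := sum_sq_le_harmonic hA T h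
  have h2 : ∑ i ∈ T, a i ^ 2 ≤ (2 * A) ^ 2 * harmonic n := by
    refine h1.trans ?_
    have := harmonic_mono hT
    nlinarith [mul_le_mul_of_nonneg_left this (sq_nonneg A)]
  have h3 := Finset.sum_mul_sq_le_sq_mul_sq T x a
  have h4 : Real.sqrt (∑ i ∈ T, a i ^ 2) ≤ 2 * A * Real.sqrt (harmonic n) := by
    refine (Real.sqrt_le_sqrt h2).trans ?_
    rw [Real.sqrt_mul (by positivity), Real.sqrt_sq (by positivity)]
  calc |∑ i ∈ T, x i * a i| ≤ Real.sqrt ((∑ i ∈ T, x i ^ 2) * ∑ i ∈ T, a i ^ 2) :=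
        Real.abs_le_sqrt h3
    _ = Real.sqrt (∑ i ∈ T, x i ^ 2) * Real.sqrt (∑ i ∈ T, a i ^ 2) :=
        Real.sqrt_mul (Finset.sum_nonneg fun _ _ => sq_nonneg _) _
    _ ≤ Real.sqrt (∑ i ∈ T, x i ^ 2) * (2 * A * Real.sqrt (harmonic n)) := by gcongr
    _ = _ := by ring

/-- Control of a bilinear form by its values on indicators of sets. -/
lemma abs_bilin_le {n : ℕ} {M : Fin n → Fin n → ℝ} {A : ℝ} (hA : 0 ≤ A) (T T' : Finset (Fin n))
    (h : ∀ I ⊆ T, ∀ J ⊆ T', |∑ i ∈ I, ∑ j ∈ J, M i j| ≤ A * Real.sqrt I.card * Real.sqrt J.card)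
    (x y : Fin n → ℝ) :
    |∑ i ∈ T, ∑ j ∈ T', x i * y j * M i j|
      ≤ 4 * A * harmonic n * Real.sqrt (∑ i, x i ^ 2) * Real.sqrt (∑ j, y j ^ 2) := by
  have hc : ∀ S : Finset (Fin n), S.card ≤ n := fun S => (Finset.card_le_univ S).trans (by simp)
  have hsub : ∀ (S : Finset (Fin n)) (z : Fin n → ℝ),
      Real.sqrt (∑ i ∈ S, z i ^ 2) ≤ Real.sqrt (∑ i, z i ^ 2) := fun S z =>
    Real.sqrt_le_sqrt (Finset.sum_le_sum_of_subset_of_nonneg (Finset.subset_univ _)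
      fun _ _ _ => sq_nonneg _)
  set L := Real.sqrt (harmonic n) with hL
  set X := Real.sqrt (∑ i, x i ^ 2) with hX
  have h1 : ∀ J ⊆ T', |∑ j ∈ J, ∑ i ∈ T, x i * M i j| ≤ (2 * A * L * X) * Real.sqrt J.card := by
    intro J hJ
    have h2 := abs_sum_mul_le (a := fun i => ∑ j ∈ J, M i j) (A := A * Real.sqrt J.card)
      (by positivity) T (hc T) (fun S hS => (h S hS J hJ).trans (le_of_eq (by ring))) x
    rw [Finset.sum_comm]
    simp_rw [← Finset.mul_sum]
    refine h2.trans ?_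
    have := hsub T x
    calc _ ≤ 2 * (A * Real.sqrt J.card) * L * X := by gcongr
      _ = _ := by ring
  have h3 := abs_sum_mul_le (a := fun j => ∑ i ∈ T, x i * M i j) (A := 2 * A * L * X)
    (by positivity) T' (hc T') h1 y
  have e : ∑ i ∈ T, ∑ j ∈ T', x i * y j * M i j = ∑ j ∈ T', y j * ∑ i ∈ T, x i * M i j := by
    rw [Finset.sum_comm]
    refine Finset.sum_congr rfl fun j _ => ?_
    rw [Finset.mul_sum]
    exact Finset.sum_congr rfl fun i _ => by ring
  rw [e]
  refine h3.trans ?_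
  have hLL : L * L = harmonic n := Real.mul_self_sqrt (harmonic_nonneg n)
  calc _ ≤ 2 * (2 * A * L * X) * L * Real.sqrt (∑ j, y j ^ 2) :=
        mul_le_mul_of_nonneg_left (hsub T' y) (by positivity)
    _ = 4 * A * (L * L) * X * Real.sqrt (∑ j, y j ^ 2) := by ring
    _ = _ := by rw [hLL]

/-! ### Decoupling. -/

/-- A uniformly random set contains `i` and misses `j` with probability `1/4`; averaging over all
sets gives the decoupling constant `4`. -/
lemma four_mul_card_separating {n : ℕ} {i j : Fin n} (hij : i ≠ j) :
    4 * ((Finset.univ : Finset (Finset (Fin n))).filter fun T => i ∈ T ∧ j ∉ T).card = 2 ^ n := by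
  have h : (Finset.univ : Finset (Finset (Fin n))).filter (fun T => i ∈ T ∧ j ∉ T)
      = ((Finset.univ.erase i).erase j).powerset.image (insert i) := by
    ext T
    simp only [Finset.mem_filter, Finset.mem_univ, true_and, Finset.mem_image, Finset.mem_powerset]
    constructor
    · rintro ⟨hi, hj⟩
      refine ⟨T.erase i, ?_, Finset.insert_erase hi⟩
      intro k hk
      rw [Finset.mem_erase] at hk
      simp only [Finset.mem_erase, Finset.mem_univ, and_true]
      exact ⟨fun h => hj (h ▸ hk.2), hk.1⟩
    · rintro ⟨S, hS, rfl⟩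
      refine ⟨Finset.mem_insert_self _ _, ?_⟩
      rw [Finset.mem_insert]
      rintro (h | h)
      · exact hij h.symm
      · simpa using hS h
  rw [h, Finset.card_image_of_injOn, Finset.card_powerset, Finset.card_erase_of_mem (by simp [hij.symm]),
    Finset.card_erase_of_mem (Finset.mem_univ _), Finset.card_univ, Fintype.card_fin]
  · have : 2 ≤ n := by
      have := i.isLt; have := j.isLt
      have : (i : ℕ) ≠ j := fun h => hij (Fin.ext h)
      omega
    obtain ⟨m, rfl⟩ := Nat.exists_eq_add_of_le this
    have : 2 + m - 1 - 1 = m := by omega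
    rw [this, pow_add]; norm_num
  · intro S hS S' hS' hSS
    have : ∀ R ∈ (((Finset.univ.erase i).erase j).powerset : Finset (Finset (Fin n))), i ∉ R := by
      intro R hR hi
      have := Finset.mem_powerset.mp hR hi
      simp at this
    have h1 := this S hS
    have h2 := this S' hS'
    rw [← Finset.erase_insert h1, ← Finset.erase_insert h2, hSS]

/-- Decoupling: an off-diagonal bilinear form is controlled by its restrictions to `T × Tᶜ`. -/
lemma abs_sum_le_of_decoupled {n : ℕ} {f : Fin n → Fin n → ℝ} {A : ℝ} (hf : ∀ i, f i i = 0)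
    (h : ∀ T : Finset (Fin n), |∑ i ∈ T, ∑ j ∈ Tᶜ, f i j| ≤ A) :
    |∑ i, ∑ j, f i j| ≤ 4 * A := by
  have key : 4 * ∑ T : Finset (Fin n), ∑ i ∈ T, ∑ j ∈ Tᶜ, f i j = 2 ^ n * ∑ i, ∑ j, f i j := by
    have e1 : ∀ T : Finset (Fin n), ∑ i ∈ T, ∑ j ∈ Tᶜ, f i j
        = ∑ i, ∑ j, if i ∈ T ∧ j ∉ T then f i j else 0 := by
      intro T
      rw [← Finset.sum_filter_add_sum_filter_not Finset.univ (fun i => i ∈ T)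
        (fun i => ∑ j, if i ∈ T ∧ j ∉ T then f i j else 0)]
      rw [Finset.sum_eq_zero (s := Finset.univ.filter fun i => ¬ i ∈ T), add_zero]
      · rw [Finset.filter_univ_mem]
        refine Finset.sum_congr rfl fun i hi => ?_
        simp only [hi, true_and]
        rw [← Finset.sum_filter]
        congr 1
        ext j; simp
      · intro i hi
        simp [(Finset.mem_filter.mp hi).2]
    simp_rw [e1]
    rw [Finset.sum_comm, Finset.mul_sum, Finset.mul_sum]
    refine Finset.sum_congr rfl fun i _ => ?_
    rw [Finset.sum_comm, Finset.mul_sum, Finset.mul_sum]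
    refine Finset.sum_congr rfl fun j _ => ?_
    by_cases hij : i = j
    · subst hij; simp [hf]
    · rw [← Finset.sum_filter, Finset.sum_const, nsmul_eq_mul, ← mul_assoc]
      congr 1
      exact_mod_cast four_mul_card_separating hij
  have h2 : |∑ T : Finset (Fin n), ∑ i ∈ T, ∑ j ∈ Tᶜ, f i j| ≤ 2 ^ n * A := by
    refine (Finset.abs_sum_le_sum_abs _ _).trans ?_
    refine (Finset.sum_le_card_nsmul _ _ A fun T _ => h T).trans (le_of_eq ?_)
    simp
  have hp : (0 : ℝ) < 2 ^ n := by positivity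
  have h3 : (2 : ℝ) ^ n * |∑ i, ∑ j, f i j| ≤ 2 ^ n * (4 * A) := by
    rw [← abs_of_pos hp, ← abs_mul, ← key, abs_mul, abs_of_pos hp, abs_of_pos (by norm_num : (0:ℝ) < 4)]
    linarith
  exact le_of_mul_le_mul_left h3 hp

/-! ### Operator norm and bilinear forms. -/

lemma opNorm_nonneg {n : ℕ} (M : Matrix (Fin n) (Fin n) ℝ) : 0 ≤ opNorm M := norm_nonneg _

lemma inner_toEuclideanCLM {n : ℕ} (M : Matrix (Fin n) (Fin n) ℝ) (x y : EuclideanSpace ℝ (Fin n)) :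
    inner ℝ x (Matrix.toEuclideanCLM (n := Fin n) (𝕜 := ℝ) M y) = ∑ i, ∑ j, x i * y j * M i j := by
  simp only [PiLp.inner_apply, Matrix.ofLp_toEuclideanCLM, Matrix.mulVec, dotProduct,
    RCLike.inner_apply, conj_trivial, Finset.sum_mul]
  exact Finset.sum_congr rfl fun i _ => Finset.sum_congr rfl fun j _ => by ring

lemma opNorm_le_of_bilin {n : ℕ} {M : Matrix (Fin n) (Fin n) ℝ} {a : ℝ} (ha : 0 ≤ a)
    (h : ∀ x y : Fin n → ℝ,
      |∑ i, ∑ j, x i * y j * M i j| ≤ a * Real.sqrt (∑ i, x i ^ 2) * Real.sqrt (∑ j, y j ^ 2)) :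
    opNorm M ≤ a := by
  refine ContinuousLinearMap.opNorm_le_bound _ ha fun y => ?_
  set z := Matrix.toEuclideanCLM (n := Fin n) (𝕜 := ℝ) M y with hz
  have h1 := h z.ofLp y.ofLp
  have e : ∀ w : EuclideanSpace ℝ (Fin n), Real.sqrt (∑ i, w.ofLp i ^ 2) = ‖w‖ := by
    intro w; rw [EuclideanSpace.norm_eq]; simp
  rw [e, e, ← inner_toEuclideanCLM, ← hz, real_inner_self_eq_norm_sq, abs_of_nonneg (sq_nonneg _)] at h1
  rcases (norm_nonneg z).eq_or_lt with h0 | h0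
  · rw [← h0]; positivity
  · have : ‖z‖ * ‖z‖ ≤ ‖z‖ * (a * ‖y‖) := by linarith [sq ‖z‖, mul_right_comm a ‖z‖ ‖y‖, mul_comm (a * ‖y‖) ‖z‖]
    exact le_of_mul_le_mul_left this h0

lemma sum_subset_le_opNorm {n : ℕ} (M : Matrix (Fin n) (Fin n) ℝ) (J : Finset (Fin n)) :
    ∑ i ∈ J, ∑ j ∈ J, M i j ≤ opNorm M * J.card := by
  set x : EuclideanSpace ℝ (Fin n) := WithLp.toLp 2 fun i => if i ∈ J then (1 : ℝ) else 0 with hx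
  have hn : ‖x‖ * ‖x‖ = J.card := by
    rw [EuclideanSpace.norm_eq, Real.mul_self_sqrt (by positivity)]
    simp [hx]
  have e : ∑ i ∈ J, ∑ j ∈ J, M i j
      = inner ℝ x (Matrix.toEuclideanCLM (n := Fin n) (𝕜 := ℝ) M x) := by
    rw [inner_toEuclideanCLM]
    simp [hx]
  rw [e, ← hn]
  calc _ ≤ ‖x‖ * ‖Matrix.toEuclideanCLM (n := Fin n) (𝕜 := ℝ) M x‖ := real_inner_le_norm _ _
    _ ≤ ‖x‖ * (opNorm M * ‖x‖) := by
      gcongr; exact ContinuousLinearMap.le_opNorm _ _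
    _ = _ := by ring

lemma opNorm_add_le {n : ℕ} (M N : Matrix (Fin n) (Fin n) ℝ) :
    opNorm (M + N) ≤ opNorm M + opNorm N := by
  unfold opNorm; rw [map_add]; exact norm_add_le _ _

lemma opNorm_diagonal_le {n : ℕ} {w : Fin n → ℝ} {a : ℝ} (ha : 0 ≤ a) (h : ∀ i, |w i| ≤ a) :
    opNorm (Matrix.diagonal w) ≤ a := by
  refine opNorm_le_of_bilin ha fun x y => ?_
  have e : ∑ i, ∑ j, x i * y j * Matrix.diagonal w i j = ∑ i, x i * (y i * w i) := by
    refine Finset.sum_congr rfl fun i _ => ?_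
    rw [Finset.sum_eq_single i]
    · simp; ring
    · intro j _ hj; simp [Matrix.diagonal_apply_ne _ hj.symm]
    · simp
  rw [e]
  have h3 := Finset.sum_mul_sq_le_sq_mul_sq Finset.univ x fun i => y i * w i
  have h4 : ∑ i, (y i * w i) ^ 2 ≤ a ^ 2 * ∑ i, y i ^ 2 := by
    rw [Finset.mul_sum]
    refine Finset.sum_le_sum fun i _ => ?_
    rw [mul_pow, mul_comm]
    exact mul_le_mul_of_nonneg_right (sq_le_sq' (abs_le.mp (h i)).1 (abs_le.mp (h i)).2)
      (sq_nonneg _)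
  calc _ ≤ Real.sqrt ((∑ i, x i ^ 2) * ∑ i, (y i * w i) ^ 2) := Real.abs_le_sqrt h3
    _ ≤ Real.sqrt ((∑ i, x i ^ 2) * (a ^ 2 * ∑ i, y i ^ 2)) := by
        gcongr
    _ = _ := by
        rw [Real.sqrt_mul (by positivity), Real.sqrt_mul (by positivity), Real.sqrt_sq ha]; ring

/-! ### Deterministic bound on the good event. -/

/-- The event on which all the linear statistics of the matrices `v_i v_iᵀ - I` used in the norm
bound have their typical size. -/
def goodEvent (n d : ℕ) (t : ℝ) : Set (Fin n → Fin d → ℝ) :=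
  {v | (∀ I J : Finset (Fin n), Disjoint I J → J.card ≤ I.card →
      |∑ i ∈ I, chaos (∑ j ∈ J, centeredOuter (v j)) (v i)|
        ≤ t * I.card * Real.sqrt (frobSq (∑ j ∈ J, centeredOuter (v j)))) ∧
    ∀ i, |chaos 1 (v i)| ≤ t * Real.sqrt d}

/-- The matrix `B` with its diagonal removed. -/
def offDiagB {n d : ℕ} (v : Fin n → Fin d → ℝ) : Matrix (Fin n) (Fin n) ℝ :=
  matB v - Matrix.diagonal fun i => matB v i i

lemma matB_comm {n d : ℕ} (v : Fin n → Fin d → ℝ) (i j : Fin n) : matB v i j = matB v j i := by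
  rw [matB_apply, matB_apply]
  simp_rw [mul_comm (v i _) (v j _)]
  ring

lemma chaos_one {d : ℕ} (x : Fin d → ℝ) : chaos 1 x = ∑ a, x a ^ 2 - d := by
  simp [chaos, Matrix.one_apply, sq]

lemma matB_self {n d : ℕ} (v : Fin n → Fin d → ℝ) (i : Fin n) :
    matB v i i = (d + chaos 1 (v i)) ^ 2 - 2 * (d + chaos 1 (v i)) + d := by
  rw [matB_apply, chaos_one]
  simp_rw [← sq]
  ring

/-- If `X > s² + s√D`, then `X (X - s²) > s² D`, contradicting the squared hypothesis. -/
lemma le_of_le_mul_sqrt_add {X s D : ℝ} (hX : 0 ≤ X) (hs : 0 ≤ s) (hD : 0 ≤ D)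
    (h : X ≤ s * Real.sqrt (D + X)) : X ≤ s ^ 2 + s * Real.sqrt D := by
  by_contra! hlt
  have h1 := pow_le_pow_left₀ hX h 2
  rw [mul_pow, Real.sq_sqrt (by positivity)] at h1
  have hd := Real.sq_sqrt hD
  have hq := Real.sqrt_nonneg D
  have ha : 0 ≤ s * Real.sqrt D := by positivity
  have h2 : s * Real.sqrt D < X - s ^ 2 := by linarith
  have h3 : s * Real.sqrt D < X := by nlinarith [sq_nonneg s]
  have h4 : (s * Real.sqrt D) * (s * Real.sqrt D) < X * (X - s ^ 2) :=
    mul_lt_mul'' h3 h2 ha ha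
  nlinarith

section good
variable {n d : ℕ} {t : ℝ} {v : Fin n → Fin d → ℝ}

lemma frobSq_sum_le (D : ℝ) (hdiag : ∀ i, matB v i i ≤ D) (J : Finset (Fin n)) :
    frobSq (∑ j ∈ J, centeredOuter (v j)) ≤ (D + opNorm (offDiagB v)) * J.card := by
  have h1 := sum_subset_le_opNorm (offDiagB v) J
  have h2 : ∑ i ∈ J, ∑ j ∈ J, offDiagB v i j
      = ∑ i ∈ J, ∑ j ∈ J, matB v i j - ∑ i ∈ J, matB v i i := by
    simp only [offDiagB, Matrix.sub_apply, Finset.sum_sub_distrib]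
    congr 1
    refine Finset.sum_congr rfl fun i hi => ?_
    rw [Finset.sum_eq_single i]
    · simp
    · intro j _ hj; exact Matrix.diagonal_apply_ne _ hj.symm
    · exact fun h => absurd hi h
  have h3 : ∑ i ∈ J, matB v i i ≤ J.card * D := by
    rw [← nsmul_eq_mul]
    exact Finset.sum_le_card_nsmul _ _ _ fun i _ => hdiag i
  rw [frobSq_sum_centeredOuter]
  linarith

/-- Self-bounding: the block estimates contain the norm being bounded, but under a square root. The
constant `16` is `4` from decoupling times `4` from `abs_bilin_le`. -/
lemma opNorm_offDiagB_le (ht : 0 ≤ t) (hv : v ∈ goodEvent n d t) {D : ℝ} (hD : 0 ≤ D)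
    (hdiag : ∀ i, matB v i i ≤ D) :
    opNorm (offDiagB v)
      ≤ (16 * harmonic n * t * Real.sqrt n) ^ 2 + 16 * harmonic n * t * Real.sqrt n * Real.sqrt D := by
  set X := opNorm (offDiagB v) with hX
  have hX0 : 0 ≤ X := opNorm_nonneg _
  have hH := harmonic_nonneg n
  set A := t * Real.sqrt n * Real.sqrt (D + X) with hA
  have hA0 : 0 ≤ A := by positivity
  have h1 : ∀ I J : Finset (Fin n), Disjoint I J → J.card ≤ I.card →
      |∑ i ∈ I, ∑ j ∈ J, matB v i j| ≤ A * Real.sqrt I.card * Real.sqrt J.card := by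
    intro I J hIJ hc
    have h2 := hv.1 I J hIJ hc
    simp_rw [chaos_sum, chaos_centeredOuter] at h2
    refine h2.trans ?_
    have h3 : Real.sqrt (frobSq (∑ j ∈ J, centeredOuter (v j)))
        ≤ Real.sqrt (D + X) * Real.sqrt J.card := by
      rw [← Real.sqrt_mul (by positivity)]
      exact Real.sqrt_le_sqrt (frobSq_sum_le D hdiag J)
    -- The tail bound is linear in `|I|`; trading one `√|I|` for `√n` produces the factor `√n`.
    have h4 : (I.card : ℝ) ≤ Real.sqrt n * Real.sqrt I.card := by
      have : Real.sqrt I.card ≤ Real.sqrt n :=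
        Real.sqrt_le_sqrt (by exact_mod_cast (Finset.card_le_univ I).trans (by simp))
      calc (I.card : ℝ) = Real.sqrt I.card * Real.sqrt I.card :=
            (Real.mul_self_sqrt (by positivity)).symm
        _ ≤ _ := by gcongr
    calc _ ≤ t * (Real.sqrt n * Real.sqrt I.card) * (Real.sqrt (D + X) * Real.sqrt J.card) := by
          gcongr
      _ = _ := by rw [hA]; ring
  have h2 : ∀ I J : Finset (Fin n), Disjoint I J →
      |∑ i ∈ I, ∑ j ∈ J, matB v i j| ≤ A * Real.sqrt I.card * Real.sqrt J.card := by
    intro I J hIJ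
    rcases le_total J.card I.card with hc | hc
    · exact h1 I J hIJ hc
    · have e : ∑ i ∈ I, ∑ j ∈ J, matB v i j = ∑ j ∈ J, ∑ i ∈ I, matB v j i := by
        refine Finset.sum_comm.trans (Finset.sum_congr rfl fun j _ => ?_)
        exact Finset.sum_congr rfl fun i _ => matB_comm v i j
      rw [e]
      have := h1 J I hIJ.symm hc
      linarith [mul_right_comm A (Real.sqrt I.card) (Real.sqrt J.card)]
  have h3 : X ≤ 16 * A * harmonic n := by
    refine opNorm_le_of_bilin (by positivity) fun x y => ?_
    have h4 := abs_sum_le_of_decoupled (f := fun i j => x i * y j * offDiagB v i j)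
      (A := 4 * A * harmonic n * Real.sqrt (∑ i, x i ^ 2) * Real.sqrt (∑ j, y j ^ 2))
      (fun i => by simp [offDiagB]) (fun T => by
        have h5 := abs_bilin_le (M := fun i j => matB v i j) hA0 T Tᶜ
          (fun I hI J hJ => h2 I J (disjoint_compl_right.mono hI hJ)) x y
        refine le_trans (le_of_eq ?_) h5
        congr 1
        refine Finset.sum_congr rfl fun i hi => Finset.sum_congr rfl fun j hj => ?_
        have hij : i ≠ j := fun h => (Finset.mem_compl.mp hj) (h ▸ hi)
        simp [offDiagB, Matrix.diagonal_apply_ne _ hij])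
    refine h4.trans (le_of_eq (by ring))
  refine le_of_le_mul_sqrt_add hX0 (by positivity) hD (h3.trans (le_of_eq ?_))
  rw [hA]; ring

/-- The norm bound on the good event. -/
lemma opNorm_le_of_mem_goodEvent (ht : 1 ≤ t) (hd : 1 ≤ d) (hv : v ∈ goodEvent n d t) :
    opNorm (matB v - ((d : ℝ) ^ 2 + (d : ℝ)) • (1 : Matrix (Fin n) (Fin n) ℝ))
      ≤ 256 * ((harmonic n : ℝ) + 1) ^ 2 * t ^ 2
        * ((d : ℝ) * Real.sqrt n + n + d * Real.sqrt d) := by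
  have hd1 : (1 : ℝ) ≤ d := by exact_mod_cast hd
  have hs1 : 1 ≤ Real.sqrt d := Real.one_le_sqrt.mpr hd1
  have hsq : Real.sqrt d * Real.sqrt d = d := Real.mul_self_sqrt (by positivity)
  have hH := harmonic_nonneg n
  set H := (harmonic n : ℝ)
  set r := Real.sqrt d with hr
  have hrd : r ≤ d := by nlinarith
  have ht2 : t ≤ t ^ 2 := by nlinarith
  -- With `|w| ≤ t√d`, the term `2dw` dominates and gives `d^{3/2}`; `7 = 2 + 1 + 2 + 2` counts the
  -- four terms.
  have hdev : ∀ i, |matB v i i - ((d : ℝ) ^ 2 + d)| ≤ 7 * t ^ 2 * (d * r) := by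
    intro i
    have hw := hv.2 i
    rw [matB_self]
    set w := chaos 1 (v i)
    have e : (d + w) ^ 2 - 2 * (d + w) + d - ((d : ℝ) ^ 2 + d)
        = 2 * d * w + w * w - 2 * w - 2 * d := by ring
    rw [e]
    have h1 : |2 * d * w + w * w - 2 * w - 2 * d|
        ≤ 2 * d * |w| + |w| * |w| + 2 * |w| + 2 * d := by
      rw [abs_le]
      have a1 := neg_abs_le w
      have a2 := le_abs_self w
      have a3 := abs_mul_abs_self w
      have a4 := mul_le_mul_of_nonneg_left a2 (by positivity : (0 : ℝ) ≤ 2 * d)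
      have a5 := mul_le_mul_of_nonneg_left a1 (by positivity : (0 : ℝ) ≤ 2 * d)
      constructor <;> nlinarith [mul_self_nonneg w]
    refine h1.trans ?_
    have hw0 := abs_nonneg w
    have hdr : (d : ℝ) ≤ d * r := by nlinarith
    have b1 : 2 * d * |w| ≤ 2 * d * (t * r) := by gcongr
    have b2 : |w| * |w| ≤ (t * r) * (t * r) := by gcongr
    have b3 : (t * r) * (t * r) = t ^ 2 * d := by rw [← hsq]; ring
    have hdr0 : 0 ≤ d * r := by positivity
    have b4 : t * r ≤ t ^ 2 * (d * r) := by
      have : r ≤ d * r := by nlinarith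
      gcongr
    have b5 : t * (d * r) ≤ t ^ 2 * (d * r) := by gcongr
    have b6 : t ^ 2 * d ≤ t ^ 2 * (d * r) := by gcongr
    have b7 : (d : ℝ) ≤ t ^ 2 * (d * r) := by nlinarith
    nlinarith
  -- `9 = 7 + 1 + 1`, a perfect square, so that `√D = 3td`.
  have hD : ∀ i, matB v i i ≤ (3 * t * d) ^ 2 := by
    intro i
    have h1 := (abs_le.mp (hdev i)).2
    have b1 : (d : ℝ) ≤ t ^ 2 * d ^ 2 := by nlinarith
    have b2 : (d : ℝ) ^ 2 ≤ t ^ 2 * d ^ 2 := by nlinarith [sq_nonneg (d : ℝ)]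
    have b3 : t ^ 2 * (d * r) ≤ t ^ 2 * d ^ 2 := by
      rw [sq (d : ℝ)]; gcongr
    nlinarith
  have hoff := opNorm_offDiagB_le (by linarith) hv (sq_nonneg (3 * t * d)) hD
  rw [Real.sqrt_sq (by positivity)] at hoff
  have hdg : opNorm (Matrix.diagonal fun i => matB v i i - ((d : ℝ) ^ 2 + d))
      ≤ 7 * t ^ 2 * (d * r) := opNorm_diagonal_le (by positivity) hdev
  have hsplit : matB v - ((d : ℝ) ^ 2 + (d : ℝ)) • (1 : Matrix (Fin n) (Fin n) ℝ)
      = offDiagB v + Matrix.diagonal fun i => matB v i i - ((d : ℝ) ^ 2 + d) := by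
    ext i j
    by_cases hij : i = j
    · subst hij; simp [offDiagB]
    · simp [offDiagB, Matrix.diagonal_apply_ne _ hij, Matrix.one_apply_ne hij]
  rw [hsplit]
  refine (opNorm_add_le _ _).trans ((add_le_add hoff hdg).trans ?_)
  set q := Real.sqrt n
  have hq : q * q = n := Real.mul_self_sqrt (by positivity)
  have hq0 : 0 ≤ q := Real.sqrt_nonneg _
  have c1 : (16 * H * t * q) ^ 2 = 256 * H ^ 2 * t ^ 2 * n := by rw [← hq]; ring
  have c2 : 16 * H * t * q * (3 * t * d) = 48 * H * t ^ 2 * (d * q) := by ring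
  rw [c1, c2]
  have e1 : 256 * H ^ 2 * t ^ 2 * n ≤ 256 * (H + 1) ^ 2 * t ^ 2 * n := by gcongr; linarith
  have e2 : 48 * H * t ^ 2 * (d * q) ≤ 256 * (H + 1) ^ 2 * t ^ 2 * (d * q) := by
    gcongr ?_ * _ * _; nlinarith
  have e3 : 7 * t ^ 2 * (d * r) ≤ 256 * (H + 1) ^ 2 * t ^ 2 * (d * r) := by
    gcongr ?_ * _ * _; nlinarith
  linarith

end good

/-! ### Probability of the good event. -/

instance isProbabilityMeasure_gaussianVectors (n d : ℕ) :
    IsProbabilityMeasure (gaussianVectors n d) := by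
  unfold gaussianVectors; infer_instance

lemma chaos_smul {d : ℕ} (c : ℝ) (U : Matrix (Fin d) (Fin d) ℝ) (x : Fin d → ℝ) :
    chaos (c • U) x = c * chaos U x := by
  simp only [chaos_eq_sum_centeredOuter, Matrix.smul_apply, smul_eq_mul, Finset.mul_sum]
  exact Finset.sum_congr rfl fun a _ => Finset.sum_congr rfl fun b _ => by ring

lemma frobSq_smul {d : ℕ} (c : ℝ) (U : Matrix (Fin d) (Fin d) ℝ) :
    frobSq (c • U) = c ^ 2 * frobSq U := by
  simp only [frobSq, Matrix.smul_apply, smul_eq_mul, Finset.mul_sum, mul_pow]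

lemma frobSq_nonneg {d : ℕ} (U : Matrix (Fin d) (Fin d) ℝ) : 0 ≤ frobSq U :=
  Finset.sum_nonneg fun _ _ => Finset.sum_nonneg fun _ _ => sq_nonneg _

lemma eq_zero_of_frobSq_eq_zero {d : ℕ} {U : Matrix (Fin d) (Fin d) ℝ} (h : frobSq U = 0) :
    U = 0 := by
  ext a b
  have h1 := (Finset.sum_eq_zero_iff_of_nonneg
    fun a _ => Finset.sum_nonneg fun b _ => sq_nonneg (U a b)).mp h a (Finset.mem_univ a)
  have h2 := (Finset.sum_eq_zero_iff_of_nonneg fun b _ => sq_nonneg (U a b)).mp h1 b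
    (Finset.mem_univ b)
  simpa using h2

section tail
variable {n d : ℕ} {U : (Fin n → Fin d → ℝ) → Matrix (Fin d) (Fin d) ℝ}

lemma measurable_chaos_comp (hU : ∀ a b, Measurable fun v => U v a b) (i : Fin n) :
    Measurable fun v => chaos (U v) (v i) := by
  unfold chaos Matrix.trace Matrix.diag
  fun_prop

/-- Exponential moment of a sum of quadratic forms whose random matrix does not depend on the
vectors that are integrated out. -/
lemma lintegral_prod_exp_chaos_le (hU : ∀ a b, Measurable fun v => U v a b)
    (hherm : ∀ v, (U v).IsHermitian) (hfrob : ∀ v, frobSq (U v) ≤ 1) (I : Finset (Fin n))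
    (hI : ∀ i ∈ I, ∀ v x, U (Function.update v i x) = U v) :
    ∫⁻ v, ∏ i ∈ I, ENNReal.ofReal (Real.exp (chaos (U v) (v i) / 4)) ∂(gaussianVectors n d)
      ≤ ENNReal.ofReal (Real.exp 1) ^ I.card := by
  have hm : ∀ S : Finset (Fin n), Measurable fun v =>
      ∏ i ∈ S, ENNReal.ofReal (Real.exp (chaos (U v) (v i) / 4)) := fun S =>
    Finset.measurable_prod _ fun i _ =>
      ENNReal.measurable_ofReal.comp (((measurable_chaos_comp hU i).div_const 4).exp)
  induction I using Finset.induction_on with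
  | empty => simp
  | insert i I hi ih =>
    have ih' := ih fun k hk => hI k (Finset.mem_insert_of_mem hk)
    rw [Finset.card_insert_of_notMem hi, pow_succ']
    refine le_trans ?_ (mul_le_mul_right ih' _)
    rw [← lintegral_const_mul _ (hm I)]
    have hUi := hI i (Finset.mem_insert_self i I)
    have hk : ∀ (v : Fin n → Fin d → ℝ) x, ∏ k ∈ I, ENNReal.ofReal (Real.exp
          (chaos (U v) (Function.update v i x k) / 4))
        = ∏ k ∈ I, ENNReal.ofReal (Real.exp (chaos (U v) (v k) / 4)) := by
      intro v x
      refine Finset.prod_congr rfl fun k hk => ?_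
      rw [Function.update_of_ne (ne_of_mem_of_not_mem hk hi)]
    -- Integrating over `v i` alone, `U v` and the remaining factors are constants.
    refine lintegral_le_of_lmarginal_le {i} (hm _) ((hm I).const_mul _) fun v => ?_
    simp only [lmarginal_singleton, Finset.prod_insert hi, hUi, Function.update_self, hk]
    rw [lintegral_mul_const _ (by have := measurable_chaos (U v); fun_prop), lintegral_const,
      measure_univ, mul_one]
    exact mul_le_mul_left (lintegral_exp_chaos_le (hherm v) (hfrob v)) _

/-- Chernoff's bound after dividing `U` by its own random Frobenius norm, which the vectors in `I`
do not affect; this replaces conditioning. The sign `s` yields both tails. -/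
lemma measure_chaos_gt_le (hU : ∀ a b, Measurable fun v => U v a b)
    (hherm : ∀ v, (U v).IsHermitian) (I : Finset (Fin n))
    (hI : ∀ i ∈ I, ∀ v x, U (Function.update v i x) = U v) {s : ℝ} (hs : s ^ 2 = 1) (t : ℝ) :
    gaussianVectors n d {v | t * I.card * Real.sqrt (frobSq (U v)) < s * ∑ i ∈ I, chaos (U v) (v i)}
      ≤ ENNReal.ofReal (Real.exp (1 - t / 4) ^ I.card) := by
  -- If `U v = 0`, division by zero makes `W v = 0`, and the strict event is then empty.
  set W : (Fin n → Fin d → ℝ) → Matrix (Fin d) (Fin d) ℝ :=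
    fun v => (s / Real.sqrt (frobSq (U v))) • U v with hW
  have hfm : Measurable fun v => frobSq (U v) := by unfold frobSq; fun_prop
  have hWm : ∀ a b, Measurable fun v => W v a b := by
    intro a b
    simp only [hW, Matrix.smul_apply, smul_eq_mul]
    have := hU a b
    fun_prop
  have hWh : ∀ v, (W v).IsHermitian := by
    intro v
    simp only [hW, Matrix.IsHermitian, Matrix.conjTranspose_smul, star_trivial, (hherm v).eq]
  have hWf : ∀ v, frobSq (W v) ≤ 1 := by
    intro v
    simp only [hW]
    rw [frobSq_smul, div_pow, Real.sq_sqrt (frobSq_nonneg _), hs, one_div]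
    exact inv_mul_le_one
  have hWI : ∀ i ∈ I, ∀ v x, W (Function.update v i x) = W v := by
    intro i hi v x
    simp only [hW, hI i hi]
  set F : (Fin n → Fin d → ℝ) → ENNReal :=
    fun v => ∏ i ∈ I, ENNReal.ofReal (Real.exp (chaos (W v) (v i) / 4)) with hF
  have hFm : Measurable F := Finset.measurable_prod _ fun i _ =>
      ENNReal.measurable_ofReal.comp (((measurable_chaos_comp hWm i).div_const 4).exp)
  have hFint := lintegral_prod_exp_chaos_le hWm hWh hWf I hWI
  have hpos : 0 < Real.exp (t * I.card / 4) := Real.exp_pos _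
  have hsub : {v | t * I.card * Real.sqrt (frobSq (U v)) < s * ∑ i ∈ I, chaos (U v) (v i)}
      ⊆ {v | ENNReal.ofReal (Real.exp (t * I.card / 4)) ≤ F v} := by
    intro v hv
    rw [Set.mem_ofPred_eq] at hv ⊢
    have hne : frobSq (U v) ≠ 0 := by
      intro h0
      rw [h0, eq_zero_of_frobSq_eq_zero h0] at hv
      simp [chaos] at hv
    have hsp : 0 < Real.sqrt (frobSq (U v)) :=
      Real.sqrt_pos.mpr (lt_of_le_of_ne (frobSq_nonneg _) hne.symm)
    simp only [hF]
    rw [← ENNReal.ofReal_prod_of_nonneg fun i _ => (Real.exp_pos _).le, ← Real.exp_sum,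
      ← Finset.sum_div]
    apply ENNReal.ofReal_le_ofReal
    apply Real.exp_le_exp.mpr
    simp only [hW, chaos_smul, ← Finset.mul_sum]
    rw [div_mul_eq_mul_div]
    have := (lt_div_iff₀ hsp).mpr hv
    linarith
  refine (measure_mono hsub).trans ?_
  refine (meas_ge_le_lintegral_div hFm.aemeasurable (by simpa using hpos) ENNReal.ofReal_ne_top).trans ?_
  refine (ENNReal.div_le_div_right hFint _).trans (le_of_eq ?_)
  rw [← ENNReal.ofReal_pow (Real.exp_pos _).le, ← ENNReal.ofReal_div_of_pos hpos]
  congr 1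
  rw [← Real.exp_nat_mul, ← Real.exp_nat_mul, ← Real.exp_sub]
  congr 1; ring

lemma measureReal_abs_chaos_gt_le (hU : ∀ a b, Measurable fun v => U v a b)
    (hherm : ∀ v, (U v).IsHermitian) (I : Finset (Fin n))
    (hI : ∀ i ∈ I, ∀ v x, U (Function.update v i x) = U v) (t : ℝ) :
    (gaussianVectors n d).real
      {v | t * I.card * Real.sqrt (frobSq (U v)) < |∑ i ∈ I, chaos (U v) (v i)|}
      ≤ 2 * Real.exp (1 - t / 4) ^ I.card := by
  have h : ∀ s : ℝ, s ^ 2 = 1 → (gaussianVectors n d).real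
      {v | t * I.card * Real.sqrt (frobSq (U v)) < s * ∑ i ∈ I, chaos (U v) (v i)}
      ≤ Real.exp (1 - t / 4) ^ I.card := fun s hs =>
    ENNReal.toReal_le_of_le_ofReal (by positivity) (measure_chaos_gt_le hU hherm I hI hs t)
  have hsub : {v | t * I.card * Real.sqrt (frobSq (U v)) < |∑ i ∈ I, chaos (U v) (v i)|}
      ⊆ {v | t * I.card * Real.sqrt (frobSq (U v)) < 1 * ∑ i ∈ I, chaos (U v) (v i)}
      ∪ {v | t * I.card * Real.sqrt (frobSq (U v)) < (-1) * ∑ i ∈ I, chaos (U v) (v i)} := by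
    intro v hv
    simpa [lt_abs] using hv
  calc _ ≤ _ := measureReal_mono hsub
    _ ≤ _ := measureReal_union_le _ _
    _ ≤ _ := add_le_add (h 1 (by norm_num)) (h (-1) (by norm_num))
    _ = _ := by ring

end tail

lemma sum_pow_card {n : ℕ} (r : ℝ) : ∑ J : Finset (Fin n), r ^ J.card = (1 + r) ^ n := by
  have := Finset.sum_pow_mul_eq_add_pow r 1 (Finset.univ : Finset (Fin n))
  simpa [add_comm] using this

lemma isHermitian_centeredOuter {d : ℕ} (x : Fin d → ℝ) : (centeredOuter x).IsHermitian := by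
  ext a b
  simp [centeredOuter, Matrix.vecMulVec_apply, mul_comm, Matrix.one_apply, eq_comm]

/-- The union bound over pairs of disjoint index sets. -/
lemma measureReal_compl_goodEvent_le (n d : ℕ) {t : ℝ} (ht : 4 ≤ t)
    (hr : n * Real.exp ((1 - t / 4) / 2) ≤ 1) :
    (gaussianVectors n d).real (goodEvent n d t)ᶜ ≤ 14 * (n * Real.exp ((1 - t / 4) / 2)) := by
  classical
  -- `r` is the square root of `q`: since `|J| ≤ |I|`, `q^|I| ≤ r^|I| r^|J|`, and the sum over pairs
  -- factorises.
  set r := Real.exp ((1 - t / 4) / 2) with hrdef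
  set q := Real.exp (1 - t / 4) with hqdef
  have hr0 : 0 < r := Real.exp_pos _
  have hr1 : r ≤ 1 := Real.exp_le_one_iff.mpr (by linarith)
  have hq : q = r * r := by rw [hqdef, hrdef, ← Real.exp_add]; congr 1; ring
  set P : Finset (Finset (Fin n) × Finset (Fin n)) :=
    Finset.univ.filter fun p => Disjoint p.1 p.2 ∧ p.2.card ≤ p.1.card ∧ p.1 ≠ ∅ with hP
  set E : Finset (Fin n) × Finset (Fin n) → Set (Fin n → Fin d → ℝ) := fun p =>
    {v | t * p.1.card * Real.sqrt (frobSq (∑ j ∈ p.2, centeredOuter (v j)))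
      < |∑ i ∈ p.1, chaos (∑ j ∈ p.2, centeredOuter (v j)) (v i)|} with hE
  set E' : Fin n → Set (Fin n → Fin d → ℝ) := fun i =>
    {v | t * ({i} : Finset (Fin n)).card * Real.sqrt (frobSq (1 : Matrix (Fin d) (Fin d) ℝ))
      < |∑ k ∈ {i}, chaos 1 (v k)|} with hE'
  have hsub : (goodEvent n d t)ᶜ ⊆ (⋃ p ∈ P, E p) ∪ ⋃ i ∈ (Finset.univ : Finset (Fin n)), E' i := by
    intro v hv
    by_contra hcon
    apply hv
    simp only [Set.mem_union, Set.mem_iUnion, not_or, not_exists] at hcon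
    refine ⟨fun I J hIJ hc => ?_, fun i => ?_⟩
    · by_cases hI : I = ∅
      · subst hI; simp
      · have := hcon.1 (I, J) (by simp [hP, hIJ, hc, hI])
        simpa [hE] using this
    · have := hcon.2 i (Finset.mem_univ i)
      have h1 : frobSq (1 : Matrix (Fin d) (Fin d) ℝ) = d := by
        simp [frobSq, Matrix.one_apply]
      simpa [hE', h1] using this
  have hEp : ∀ p ∈ P, (gaussianVectors n d).real (E p) ≤ 2 * (r ^ p.1.card * r ^ p.2.card) := by
    intro p hp
    simp only [hP, Finset.mem_filter, Finset.mem_univ, true_and] at hp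
    have h1 := measureReal_abs_chaos_gt_le (n := n) (d := d)
      (U := fun v => ∑ j ∈ p.2, centeredOuter (v j))
      (by
        intro a b
        simp only [Matrix.sum_apply, centeredOuter, Matrix.sub_apply, Matrix.vecMulVec_apply]
        fun_prop)
      (by
        intro v
        unfold Matrix.IsHermitian
        rw [Matrix.conjTranspose_sum]
        exact Finset.sum_congr rfl fun j _ => isHermitian_centeredOuter _)
      p.1
      (by
        intro i hi v x
        refine Finset.sum_congr rfl fun j hj => ?_
        rw [Function.update_of_ne]
        rintro rfl
        exact Finset.disjoint_left.mp hp.1 hi hj) t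
    refine h1.trans ?_
    rw [← hqdef, hq, mul_pow]
    gcongr 2 * (_ * ?_)
    exact pow_le_pow_of_le_one hr0.le hr1 hp.2.1
  have hEi : ∀ i ∈ (Finset.univ : Finset (Fin n)), (gaussianVectors n d).real (E' i) ≤ 2 * r := by
    intro i _
    have h1 := measureReal_abs_chaos_gt_le (n := n) (d := d)
      (U := fun _ => (1 : Matrix (Fin d) (Fin d) ℝ)) (fun _ _ => measurable_const)
      (fun _ => Matrix.isHermitian_one) {i} (fun _ _ _ _ => rfl) t
    refine h1.trans ?_
    rw [← hqdef, hq, Finset.card_singleton, pow_one]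
    nlinarith
  -- Excluding `I = ∅` removes the term `1`, leaving a total of order `n r`.
  have hPsum : ∑ p ∈ P, r ^ p.1.card * r ^ p.2.card ≤ ((1 + r) ^ n - 1) * (1 + r) ^ n := by
    have hPsub : P ⊆ (Finset.univ.erase ∅) ×ˢ Finset.univ := by
      intro p hp
      simp only [hP, Finset.mem_filter, Finset.mem_univ, true_and] at hp
      simp [hp.2.2]
    refine (Finset.sum_le_sum_of_subset_of_nonneg hPsub fun _ _ _ => by positivity).trans
      (le_of_eq ?_)
    rw [Finset.sum_product]
    dsimp only
    rw [← Finset.sum_mul_sum, sum_pow_card]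
    congr 1
    rw [← sum_pow_card r, ← Finset.add_sum_erase _ _ (Finset.mem_univ (∅ : Finset (Fin n)))]
    simp
  have hexp : (1 + r) ^ n ≤ 1 + 2 * (n * r) := by
    have h0 : 0 ≤ n * r := by positivity
    have h1 : (1 + r) ^ n ≤ Real.exp (n * r) := by
      rw [Real.exp_nat_mul]
      gcongr
      rw [add_comm]; exact Real.add_one_le_exp r
    have h2 := (abs_le.mp (Real.abs_exp_sub_one_sub_id_le (x := n * r) (by rwa [abs_of_nonneg h0]))).2
    nlinarith
  have hone : 1 ≤ (1 + r) ^ n := one_le_pow₀ (by linarith)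
  calc (gaussianVectors n d).real (goodEvent n d t)ᶜ ≤ _ := measureReal_mono hsub
    _ ≤ _ := measureReal_union_le _ _
    _ ≤ ∑ p ∈ P, (gaussianVectors n d).real (E p)
        + ∑ i ∈ (Finset.univ : Finset (Fin n)), (gaussianVectors n d).real (E' i) :=
      add_le_add (measureReal_biUnion_finset_le _ _) (measureReal_biUnion_finset_le _ _)
    _ ≤ ∑ p ∈ P, 2 * (r ^ p.1.card * r ^ p.2.card)
        + ∑ i ∈ (Finset.univ : Finset (Fin n)), 2 * r :=
      add_le_add (Finset.sum_le_sum hEp) (Finset.sum_le_sum hEi)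
    _ = 2 * ∑ p ∈ P, r ^ p.1.card * r ^ p.2.card + 2 * (n * r) := by
      rw [← Finset.mul_sum]; simp; ring
    _ ≤ 2 * (((1 + r) ^ n - 1) * (1 + r) ^ n) + 2 * (n * r) := by gcongr
    _ ≤ 2 * ((2 * (n * r)) * 3) + 2 * (n * r) := by
      gcongr <;> linarith
    _ = _ := by ring

/-! ### Choice of the parameter `t`. -/

/-- The operator norm bound holds with probability at least `1 - d^(-c)`. -/
lemma measureReal_opNorm_le {c : ℝ} (hc : 0 < c) {n d : ℕ} (hd : 2 ≤ d) (hn : n ≤ d ^ 2) :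
    1 - (d : ℝ) ^ (-c) ≤ (gaussianVectors n d).real
      {v | opNorm (matB v - ((d : ℝ) ^ 2 + (d : ℝ)) • (1 : Matrix (Fin n) (Fin n) ℝ))
        ≤ 256 * 36 * 64 * (c + 7) ^ 2 * Real.log d ^ 4
          * ((d : ℝ) * Real.sqrt n + n + (d : ℝ) ^ (3 / 2 : ℝ))} := by
  have hd2 : (2 : ℝ) ≤ d := by exact_mod_cast hd
  have hdpos : (0 : ℝ) < d := by linarith
  have hn2 : (n : ℝ) ≤ (d : ℝ) ^ 2 := by exact_mod_cast hn
  set l := Real.log d with hl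
  have hl2 : 1 / 2 ≤ l := by
    have h1 := Real.log_two_gt_d9
    have h2 := Real.log_le_log (by norm_num) hd2
    linarith
  -- Then `(1 - t/4)/2 = 1/2 - (c + 7) l ≤ -(c + 6) l` because `l ≥ 1/2`. With `n ≤ d²` and `d⁴ ≥
  -- 16`, the failure probability is at most `(14/16) d^{-c}`.
  set t := 8 * (c + 7) * l with ht
  have ht4 : 4 ≤ t := by nlinarith
  have hr : Real.exp ((1 - t / 4) / 2) ≤ (d : ℝ) ^ (-c) * ((d : ℝ) ^ 6)⁻¹ := by
    have : (d : ℝ) ^ (-c) * ((d : ℝ) ^ 6)⁻¹ = Real.exp (l * (-c - 6)) := by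
      rw [hl, ← Real.rpow_def_of_pos hdpos, Real.rpow_sub hdpos, div_eq_mul_inv]
      congr 2
      exact_mod_cast (Real.rpow_natCast (d : ℝ) 6).symm
    rw [this]
    apply Real.exp_le_exp.mpr
    rw [ht]; nlinarith
  have hdc : (d : ℝ) ^ (-c) ≤ 1 := Real.rpow_le_one_of_one_le_of_nonpos (by linarith) (by linarith)
  have hdc0 : 0 < (d : ℝ) ^ (-c) := Real.rpow_pos_of_pos hdpos _
  have hnr : n * Real.exp ((1 - t / 4) / 2) ≤ (d : ℝ) ^ (-c) * (1 / 16) := by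
    calc n * Real.exp ((1 - t / 4) / 2) ≤ (d : ℝ) ^ 2 * ((d : ℝ) ^ (-c) * ((d : ℝ) ^ 6)⁻¹) := by
          gcongr
      _ = (d : ℝ) ^ (-c) * ((d : ℝ) ^ 4)⁻¹ := by field_simp
      _ ≤ (d : ℝ) ^ (-c) * (1 / 16) := by
          gcongr
          rw [one_div]
          gcongr
          calc (16 : ℝ) = 2 ^ 4 := by norm_num
            _ ≤ _ := by gcongr
  have hcompl := measureReal_compl_goodEvent_le n d ht4 (by linarith)
  have hgood : 1 - (d : ℝ) ^ (-c) ≤ (gaussianVectors n d).real (goodEvent n d t) := by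
    have h1 : 1 ≤ (gaussianVectors n d).real (goodEvent n d t)
        + (gaussianVectors n d).real (goodEvent n d t)ᶜ := by
      have := measureReal_union_le (μ := gaussianVectors n d) (goodEvent n d t) (goodEvent n d t)ᶜ
      rwa [Set.union_compl_self, probReal_univ] at this
    linarith
  refine hgood.trans (measureReal_mono fun v hv => ?_)
  refine (opNorm_le_of_mem_goodEvent (by linarith) (by omega) hv).trans ?_
  -- `2 + 2l ≤ 6l` as `l ≥ 1/2`. The final power `log⁴` comes from two factors `harmonic n + 1` and
  -- two factors `t`.
  have hH : (harmonic n : ℝ) + 1 ≤ 6 * l := by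
    have h1 := harmonic_le_one_add_log n
    have h2 : Real.log n ≤ 2 * l := by
      rcases Nat.eq_zero_or_pos n with h0 | h0
      · subst h0; simp; linarith
      · have := Real.log_le_log (by exact_mod_cast h0) hn2
        rwa [Real.log_pow, Nat.cast_ofNat] at this
    linarith
  have hsqrt : (d : ℝ) * Real.sqrt d = (d : ℝ) ^ (3 / 2 : ℝ) := by
    rw [Real.sqrt_eq_rpow, ← Real.rpow_one_add' hdpos.le (by norm_num)]
    norm_num
  rw [hsqrt]
  have hH0 := harmonic_nonneg n
  calc _ ≤ 256 * (6 * l) ^ 2 * t ^ 2 * ((d : ℝ) * Real.sqrt n + n + (d : ℝ) ^ (3 / 2 : ℝ)) := by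
        gcongr
    _ = _ := by rw [ht]; ring

end EllipsoidFitting

theorem mainTheorem2 :
    (∀ (n d : ℕ) (v : Fin n → Fin d → ℝ),
      EllipsoidFitting.matB v - ((d : ℝ) ^ 2 + (d : ℝ)) • (1 : Matrix (Fin n) (Fin n) ℝ)
        = -EllipsoidFitting.matDelta v) ∧
    ∃ K : ℕ, ∀ c : ℝ, 0 < c → ∃ C : ℝ, 0 < C ∧
      ∀ n d : ℕ, 2 ≤ d → n ≤ d ^ 2 →
        1 - (d : ℝ) ^ (-c) ≤
          (EllipsoidFitting.gaussianVectors n d).real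
            {v | EllipsoidFitting.opNorm
                  (EllipsoidFitting.matB v
                    - ((d : ℝ) ^ 2 + (d : ℝ)) • (1 : Matrix (Fin n) (Fin n) ℝ))
                ≤ C * Real.log (d : ℝ) ^ K *
                  ((d : ℝ) * Real.sqrt (n : ℝ) + (n : ℝ) + (d : ℝ) ^ (3 / 2 : ℝ))} :=
  ⟨fun _ _ v => EllipsoidFitting.matB_sub_eq_neg_matDelta v, 4, fun c hc =>
    ⟨256 * 36 * 64 * (c + 7) ^ 2, by positivity, fun _ _ hd hn =>
      EllipsoidFitting.measureReal_opNorm_le hc hd hn⟩⟩
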